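/- **Setting.** Work in max algebra over $\mathbb{R}_+=[0,\infty)$ with $a\oplus b=\max(a,b)$, $a\otimes b=ab$, extended to matrices and vectors in the usual way; $A^r=(a^{(r)}_{ij})$ denotes the max-algebraic power ($A^0=I$). Let $A=(a_{ij})\in\mathbb{R}_+^{n\times n}$. * $A$ is *irreducible* if in the digraph $\mathcal D(A)$ with edges $\{(i,j): a_{ij}\ne 0\}$ every node has a path to every node. Let $\lambda(A)=\max_{1\le k\le n}\bigl(\max_i a^{(k)}_{ii}\bigr)^{1/k}$, the maximum cycle geometric mean. The *critical graph* $\mathcal C(A)$ consists of all nodes and edges on cycles of $\mathcal D(A)$ whose geometric mean equals $\lambda(A)$. $A$ is *visualized* if $\lambda(A)=1$, $a_{ij}\le 1$ for all $i,j$, and $a_{ij}=1$ for every edge $(i,j)$ of $\mathcal C(A)$. * The strongly connected components $\mathcal C_\mu$ of $\mathcal C(A)$ have node sets $N_\mu$ and cyclicities $\gamma_\mu$ (the g.c.d. of the lengths of all cycles of $\mathcal C_\mu$); $\gamma=\operatorname{lcm}_\mu\gamma_\mu$. Each non-critical node $t$ is regarded as a further, non-critical component $\nu(t)$ with node set $\{t\}$.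 * For critical nodes $i,j$ of the same component $\mathcal C_\mu$, $i\sim j$ if some path of $\mathcal C(A)$ from $i$ to $j$ has length divisible by $\gamma_\mu$; the equivalence classes $[i]$ are the *cyclic classes*. Write $[i]\to_1[j]$ if some path of $\mathcal C(A)$ from a node of $[i]$ to a node of $[j]$ has length $\equiv 1 \pmod{\gamma_\mu}$. * The transient $T(A)$ is the least $T\ge 0$ with $A^{s+\gamma}=A^s$ for all $s\ge T$. * The *core matrix* $A^{Core}=(\alpha_{\mu\nu})$, with $\mu,\nu$ ranging over all critical and non-critical components, is given by $\alpha_{\mu\nu}=\max\{a_{ij}: i\in N_\mu, j\in N_\nu\}$, and $\alpha^*_{\mu\nu}$ are the entries of its Kleene star $I\oplus A^{Core}\oplus (A^{Core})^2\oplus\cdots$. * For $i\in N_\mu$ critical and a component $\mathcal C_\nu\neq\mathcal C_\mu$ of $\mathcal C(A)$ put $M_\nu^{(r)}(i)=\{j\in N_\nu: a^{(r)}_{ij}=\alpha^*_{\mu\nu}\}$ and $K^{(r)}(i)=\{t \text{ non-critical}: a^{(r)}_{it}=\alpha^*_{\mu\nu(t)}\}$. * $\operatorname{Attr}(A,1)=\{x\in\mathbb{R}_+^n: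 A^s\otimes x=A^{s+1}\otimes x\text{ for some }s\ge 0\}$. **Theorem 6.1.** Let $A\in\mathbb{R}_+^{n\times n}$ be visualized and irreducible, and let $r\ge T(A)$ be a multiple of $\gamma$. Then: 1. the solution set of $A^r\otimes x=A^{r+1}\otimes x$ in $\mathbb{R}_+^n$ is $\operatorname{Attr}(A,1)$; 2. for critical $i$, the sets $M_\nu^{(r)}(i)$ and $K^{(r)}(i)$ depend only on the cyclic class $[i]$; 3. a vector $x\in\mathbb{R}_+^n$ satisfies $A^r\otimes x=A^{r+1}\otimes x$ if and only if $$\bigoplus_{k\in[i]}x_k\oplus\bigoplus_{\mathcal C_\nu\ne\mathcal C_\mu}\alpha^*_{\mu\nu}\Bigl(\bigoplus_{k\in M_\nu^{(r)}(i)}x_k\Bigr)\oplus\bigoplus_{t\in K^{(r)}(i)}\alpha^*_{\mu\nu(t)}x_t=\bigoplus_{k\in[j]}x_k\oplus\bigoplus_{\mathcal C_\nu\ne\mathcal C_\mu}\alpha^*_{\mu\nu}\Bigl(\bigoplus_{k\in M_\nu^{(r)}(j)}x_k\Bigr)\oplus\bigoplus_{t\in K^{(r)}(j)}\alpha^*_{\mu\nu(t)}x_t$$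 for all pairs of cyclic classes with $[i]\to_1[j]$, where $\mathcal C_\mu$ is the component of $\mathcal C(A)$ containing both $[i]$ and $[j]$, and $\mathcal C_\nu$ runs over the other components of $\mathcal C(A)$. -/

import Mathlib

open scoped NNReal

noncomputable section

namespace MaxAlg

/-! ### Max algebra: the semiring of nonnegative reals with `a ⊕ b = max a b`, `a ⊗ b = a * b` -/

section Basic

variable {κ : Type*} [Fintype κ]

/-- The max-algebraic product `(A ⊗ B) i j = max_k A i k * B k j`. -/
def maxMul (A B : Matrix κ κ ℝ≥0) : Matrix κ κ ℝ≥0 :=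
  fun i j => Finset.univ.sup fun k => A i k * B k j

/-- The max-algebraic matrix-vector product `(A ⊗ x) i = max_j A i j * x j`. -/
def maxMulVec (A : Matrix κ κ ℝ≥0) (x : κ → ℝ≥0) : κ → ℝ≥0 :=
  fun i => Finset.univ.sup fun j => A i j * x j

open Classical in
/-- The max-algebraic powers: `A ^ 0` is the identity matrix, `A ^ (r + 1) = A ^ r ⊗ A`. -/
def maxPow (A : Matrix κ κ ℝ≥0) : ℕ → Matrix κ κ ℝ≥0
  | 0 => fun i j => if i = j then 1 else 0
  | r + 1 => maxMul (maxPow A r) A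

/-- The Kleene star `I ⊕ A ⊕ A ^ 2 ⊕ ⋯`, entrywise supremum of all powers (finite as soon as
the maximum cycle mean is at most `1`, in particular if all entries are at most `1`). -/
def kleeneStar (A : Matrix κ κ ℝ≥0) : Matrix κ κ ℝ≥0 :=
  fun i j => ⨆ k : ℕ, maxPow A k i j

/-- `λ(A) = max_{1 ≤ k ≤ n} (max_i (A ^ k) i i) ^ (1 / k)`, the maximum geometric mean of the
cycles of the weighted digraph of `A` (and `0` if there is no cycle). -/
def maxCycleMean (A : Matrix κ κ ℝ≥0) : ℝ≥0 :=
  (Finset.Icc 1 (Fintype.card κ)).sup fun k =>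
    (Finset.univ.sup fun i => maxPow A k i i) ^ (1 / (k : ℝ))

/-- The attraction cone `Attr(A, t)`: the vectors whose orbit ultimately satisfies
`A ^ r ⊗ x = A ^ (r + t) ⊗ x`. -/
def attr (A : Matrix κ κ ℝ≥0) (t : ℕ) : Set (κ → ℝ≥0) :=
  {x | ∃ r : ℕ, maxMulVec (maxPow A r) x = maxMulVec (maxPow A (r + t)) x}

end Basic

/-- There is a path with exactly `k` edges from `i` to `j` in the digraph with edge relation
`E`. -/
def HasPath {κ : Type*} (E : κ → κ → Prop) (k : ℕ) (i j : κ) : Prop :=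
  ∃ p : ℕ → κ, p 0 = i ∧ p k = j ∧ ∀ s < k, E (p s) (p (s + 1))

variable {ι : Type*} [Fintype ι]

/-- `A` is irreducible: in the digraph of nonzero entries every node has a path to every node. -/
def Irred (A : Matrix ι ι ℝ≥0) : Prop :=
  ∀ i j : ι, Relation.ReflTransGen (fun u v => A u v ≠ 0) i j

/-! ### The critical graph -/

/-- `(σ 0, …, σ k)`, `σ k = σ 0`, is a critical cycle: a cycle of length `k ≥ 1` along nonzero
entries of `A` whose geometric mean is `λ(A)`. Only the values `σ 0, …, σ k` matter. -/
def IsCriticalCycle (A : Matrix ι ι ℝ≥0) (k : ℕ) (σ : ℕ → ι) : Prop :=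
  0 < k ∧ σ k = σ 0 ∧ (∀ s < k, A (σ s) (σ (s + 1)) ≠ 0) ∧
    (∏ s ∈ Finset.range k, A (σ s) (σ (s + 1))) ^ (1 / (k : ℝ)) = maxCycleMean A

/-- The edges of the critical graph. -/
def CritEdge (A : Matrix ι ι ℝ≥0) (i j : ι) : Prop :=
  ∃ (k : ℕ) (σ : ℕ → ι), IsCriticalCycle A k σ ∧ ∃ s < k, σ s = i ∧ σ (s + 1) = j

/-- The nodes of the critical graph. -/
def CritNode (A : Matrix ι ι ℝ≥0) (i : ι) : Prop :=
  ∃ (k : ℕ) (σ : ℕ → ι), IsCriticalCycle A k σ ∧ ∃ s < k, σ s = i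

/-- Mutual accessibility in the critical graph. A node that is not critical is equivalent to
itself only, so the classes are the strongly connected components of the critical graph and one
artificial component `{t}` for each non-critical node `t`. -/
def compSetoid (A : Matrix ι ι ℝ≥0) : Setoid ι where
  r i j := Relation.ReflTransGen (CritEdge A) i j ∧ Relation.ReflTransGen (CritEdge A) j i
  iseqv :=
    { refl := fun _ => ⟨.refl, .refl⟩
      symm := fun h => ⟨h.2, h.1⟩
      trans := fun h₁ h₂ => ⟨h₁.1.trans h₂.1, h₂.2.trans h₁.2⟩ }

/-- The index set of all components, critical and (artificial) non-critical ones. -/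
def Comp (A : Matrix ι ι ℝ≥0) : Type _ := Quotient (compSetoid A)

/-- The component of a node; the node set `N_μ` is `{i | comp A i = μ}`. -/
def comp (A : Matrix ι ι ℝ≥0) (i : ι) : Comp A := Quotient.mk (compSetoid A) i

instance (A : Matrix ι ι ℝ≥0) : Finite (Comp A) :=
  inferInstanceAs (Finite (Quotient (compSetoid A)))

instance (A : Matrix ι ι ℝ≥0) : Fintype (Comp A) := Fintype.ofFinite _

/-- `μ` is a component of the critical graph. -/
def CritComp (A : Matrix ι ι ℝ≥0) (μ : Comp A) : Prop := ∃ i, CritNode A i ∧ comp A i = μ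

/-- The cyclicity `γ_μ` of a component of the critical graph: the greatest common divisor of the
lengths of all its cycles. -/
def compCyclicity (A : Matrix ι ι ℝ≥0) (μ : Comp A) : ℕ :=
  sSup {d : ℕ | ∀ k : ℕ, 0 < k → ∀ i, comp A i = μ → HasPath (CritEdge A) k i i → d ∣ k}

open Classical in
/-- The cyclicity `γ` of the critical graph: the least common multiple of the cyclicities of its
strongly connected components. -/
def cyclicity (A : Matrix ι ι ℝ≥0) : ℕ :=
  (Finset.univ.filter (CritComp A)).lcm (compCyclicity A)

/-- `i ∼ j`: the nodes lie in the same component `μ` and some path from `i` to `j` in the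
critical graph has length divisible by `γ_μ`. -/
def CyclicEquiv (A : Matrix ι ι ℝ≥0) (i j : ι) : Prop :=
  comp A i = comp A j ∧
    ∃ k : ℕ, HasPath (CritEdge A) k i j ∧ k ≡ 0 [MOD compCyclicity A (comp A i)]

open Classical in
/-- The cyclic class `[i]`. -/
def cyclicClass (A : Matrix ι ι ℝ≥0) (i : ι) : Finset ι :=
  Finset.univ.filter fun j => CyclicEquiv A i j

/-- The access relation `[i] →_t [j]`: some path of the critical graph leads from a node of `[i]`
to a node of `[j]` and has length congruent to `t` modulo `γ_μ`, where `μ` is the component of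
`i`. -/
def Access (A : Matrix ι ι ℝ≥0) (t : ℕ) (i j : ι) : Prop :=
  ∃ i' ∈ cyclicClass A i, ∃ j' ∈ cyclicClass A j, ∃ k : ℕ,
    HasPath (CritEdge A) k i' j' ∧ k ≡ t [MOD compCyclicity A (comp A i)]

/-! ### Visualized matrices, the transient, and the core matrix -/

/-- `A` is definite: `λ(A) = 1`. -/
def Definite (A : Matrix ι ι ℝ≥0) : Prop := maxCycleMean A = 1

/-- `A` is visualized: definite, all entries at most `1`, and critical entries equal to `1`. -/
def Visualized (A : Matrix ι ι ℝ≥0) : Prop :=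
  Definite A ∧ (∀ i j, A i j ≤ 1) ∧ ∀ i j, CritEdge A i j → A i j = 1

/-- The transient `T(A)`: the least `T` such that `A ^ (s + γ) = A ^ s` for all `s ≥ T`. -/
def transient (A : Matrix ι ι ℝ≥0) : ℕ :=
  sInf {T : ℕ | ∀ s, T ≤ s → maxPow A (s + cyclicity A) = maxPow A s}

open Classical in
/-- The core matrix: `α_{μν}` is the greatest entry of `A` in the rows `N_μ` and columns `N_ν`. -/
def core (A : Matrix ι ι ℝ≥0) : Matrix (Comp A) (Comp A) ℝ≥0 :=
  fun μ ν => (Finset.univ.filter fun i => comp A i = μ).sup fun i =>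
    (Finset.univ.filter fun j => comp A j = ν).sup fun j => A i j

/-- The entries `α*_{μν}` of the Kleene star of the core matrix. -/
def coreStar (A : Matrix ι ι ℝ≥0) : Matrix (Comp A) (Comp A) ℝ≥0 := kleeneStar (core A)

/-! ### The concise system -/

open Classical in
/-- `M_ν^{(r)}(i)`: the nodes `j` of `N_ν` with `(A ^ r) i j = α*_{μν}`, where `μ` is the
component of `i`. -/
def indexM (A : Matrix ι ι ℝ≥0) (r : ℕ) (ν : Comp A) (i : ι) : Finset ι :=
  Finset.univ.filter fun j => comp A j = ν ∧ maxPow A r i j = coreStar A (comp A i) ν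

open Classical in
/-- `K^{(r)}(i)`: the non-critical nodes `t` with `(A ^ r) i t = α*_{μν(t)}`, where `μ` is the
component of `i` and `ν(t)` is the component `{t}`. -/
def indexK (A : Matrix ι ι ℝ≥0) (r : ℕ) (i : ι) : Finset ι :=
  Finset.univ.filter fun t =>
    ¬ CritNode A t ∧ maxPow A r i t = coreStar A (comp A i) (comp A t)

open Classical in
/-- The side of an equation of the concise system that belongs to the cyclic class `[i]`. -/
def chainSide (A : Matrix ι ι ℝ≥0) (r : ℕ) (i : ι) (x : ι → ℝ≥0) : ℝ≥0 :=
  (cyclicClass A i).sup x ⊔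
    ((Finset.univ.filter fun ν => CritComp A ν ∧ ν ≠ comp A i).sup fun ν =>
      coreStar A (comp A i) ν * (indexM A r ν i).sup x) ⊔
    ((indexK A r i).sup fun t => coreStar A (comp A i) (comp A t) * x t)

end MaxAlg

end

/-!
The theorem rests on three facts about an irreducible visualized matrix `A` and an exponent `r` in
the periodic regime.

*Periodicity.* All entries are at most `1`, so cutting cycles whose length is divisible by the
cyclicity `γ` never decreases the weight of a walk (`exists_small_exponent`). Conversely, closed
walks of weight `1` are available at a critical node for all large multiples of the cyclicity of its
component (`CritNode.exists_closed_walks`). Hence the critical rows of the powers are ultimately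
periodic (`Visualized.exists_dominatesFrom`). Walks that avoid the critical nodes decay
geometrically, whereas the nonzero entries of large powers stay away from `0`; so large powers
factor through critical nodes reached after boundedly many steps (`Visualized.exists_factor`). This
yields the cyclicity theorem (`Visualized.exists_period`), without which the transient would not be
meaningful, and it shows that the equations of `A ^ r ⊗ x = A ^ (r + 1) ⊗ x` at the non-critical
nodes follow from those at the critical nodes (`Visualized.maxMulVec_eq_of_crit`).

*Critical rows.* Following a critical path of length `k` from `i` to `j` turns row `i` of
`A ^ (s + k)` into row `j` of `A ^ s`, and only `k` modulo the cyclicity of the component matters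
(`Visualized.row_shift_of_modEq`). So rows depend only on cyclic classes, and the system says exactly
that `A ^ r ⊗ x` is constant on every component of the critical graph.

*Dropping terms.* Every entry of row `i` of `A ^ r` is bounded by the corresponding `α*`, and in each
column the bound is attained in some row of the component of `i`
(`Visualized.exists_maxPow_eq_coreStar`). Once either the full rows or the concise sides are constant
on the component, a term whose entry is smaller than `α*` cannot matter, so the two agree.
-/


namespace MaxAlg

/-! ### Max-algebraic products and powers -/

section Powers

variable {κ : Type*} [Fintype κ] {A B : Matrix κ κ ℝ≥0}

theorem exists_eq_sup_univ [Nonempty κ] (f : κ → ℝ≥0) : ∃ u, Finset.univ.sup f = f u := by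
  obtain ⟨u, -, hu⟩ := Finset.exists_mem_eq_sup Finset.univ Finset.univ_nonempty f
  exact ⟨u, hu⟩

theorem le_maxMul (A B : Matrix κ κ ℝ≥0) (i k j : κ) : A i k * B k j ≤ maxMul A B i j :=
  Finset.le_sup (f := fun k => A i k * B k j) (Finset.mem_univ k)

theorem exists_maxMul (A B : Matrix κ κ ℝ≥0) (i j : κ) :
    ∃ k, maxMul A B i j = A i k * B k j :=
  have : Nonempty κ := ⟨i⟩
  exists_eq_sup_univ _

theorem le_maxMulVec (A : Matrix κ κ ℝ≥0) (x : κ → ℝ≥0) (i j : κ) :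
    A i j * x j ≤ maxMulVec A x i :=
  Finset.le_sup (f := fun j => A i j * x j) (Finset.mem_univ j)

theorem exists_maxMulVec (A : Matrix κ κ ℝ≥0) (x : κ → ℝ≥0) (i : κ) :
    ∃ j, maxMulVec A x i = A i j * x j :=
  have : Nonempty κ := ⟨i⟩
  exists_eq_sup_univ _

theorem maxMulVec_le {x : κ → ℝ≥0} {i : κ} {c : ℝ≥0} (h : ∀ j, A i j * x j ≤ c) :
    maxMulVec A x i ≤ c :=
  Finset.sup_le fun j _ => h j

theorem maxMulVec_congr_row {i j : κ} (h : ∀ l, A i l = B j l) (x : κ → ℝ≥0) :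
    maxMulVec A x i = maxMulVec B x j := by
  simp only [maxMulVec, h]

theorem maxPow_zero_self (A : Matrix κ κ ℝ≥0) (i : κ) : maxPow A 0 i i = 1 := by
  simp [maxPow]

theorem maxPow_zero_of_ne (A : Matrix κ κ ℝ≥0) {i j : κ} (h : i ≠ j) : maxPow A 0 i j = 0 := by
  simp [maxPow, h]

theorem maxPow_mul_le (A : Matrix κ κ ℝ≥0) (a b : ℕ) (i k j : κ) :
    maxPow A a i k * maxPow A b k j ≤ maxPow A (a + b) i j := by
  induction b generalizing j with
  | zero =>
    by_cases h : k = j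
    · subst h; simp [maxPow_zero_self]
    · simp [maxPow_zero_of_ne A h]
  | succ b ih =>
    obtain ⟨u, hu⟩ := exists_maxMul (maxPow A b) A k j
    calc maxPow A a i k * maxPow A (b + 1) k j
        = (maxPow A a i k * maxPow A b k u) * A u j := by rw [maxPow, hu, mul_assoc]
      _ ≤ maxPow A (a + b) i u * A u j := by gcongr; exact ih u
      _ ≤ maxPow A (a + (b + 1)) i j := le_maxMul _ _ _ _ _

theorem exists_maxPow_add (A : Matrix κ κ ℝ≥0) (a b : ℕ) (i j : κ) :
    ∃ k, maxPow A (a + b) i j = maxPow A a i k * maxPow A b k j := by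
  suffices ∃ k, maxPow A (a + b) i j ≤ maxPow A a i k * maxPow A b k j by
    obtain ⟨k, hk⟩ := this
    exact ⟨k, hk.antisymm (maxPow_mul_le A a b i k j)⟩
  induction b generalizing j with
  | zero => exact ⟨j, by simp [maxPow_zero_self]⟩
  | succ b ih =>
    obtain ⟨u, hu⟩ := exists_maxMul (maxPow A (a + b)) A i j
    obtain ⟨k, hk⟩ := ih u
    refine ⟨k, ?_⟩
    calc maxPow A (a + (b + 1)) i j = maxPow A (a + b) i u * A u j := hu
      _ ≤ maxPow A a i k * (maxPow A b k u * A u j) := by rw [← mul_assoc]; gcongr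
      _ ≤ maxPow A a i k * maxPow A (b + 1) k j := by
          gcongr; exact le_maxMul _ _ _ _ _

theorem maxMulVec_maxPow_add (A : Matrix κ κ ℝ≥0) (a b : ℕ) (x : κ → ℝ≥0) :
    maxMulVec (maxPow A (a + b)) x = maxMulVec (maxPow A a) (maxMulVec (maxPow A b) x) := by
  funext i
  refine le_antisymm (maxMulVec_le fun j => ?_) (maxMulVec_le fun k => ?_)
  · obtain ⟨k, hk⟩ := exists_maxPow_add A a b i j
    rw [hk, mul_assoc]
    exact (mul_le_mul_right (le_maxMulVec _ x k j) _).trans (le_maxMulVec _ _ i k)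
  · obtain ⟨j, hj⟩ := exists_maxMulVec (maxPow A b) x k
    rw [hj, ← mul_assoc]
    exact (mul_le_mul_left (maxPow_mul_le A a b i k j) _).trans (le_maxMulVec _ _ i j)

theorem maxPow_le_one (h : ∀ i j, A i j ≤ 1) (s : ℕ) (i j : κ) : maxPow A s i j ≤ 1 := by
  induction s generalizing j with
  | zero =>
    by_cases hij : i = j
    · subst hij; simp [maxPow_zero_self]
    · simp [maxPow_zero_of_ne A hij]
  | succ s ih => exact Finset.sup_le fun k _ => mul_le_one' (ih k) (h k j)

/-- The nonzero entries of a power are bounded below in terms of the exponent, because the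
matrix has only finitely many entries. -/
theorem exists_pos_le_maxPow (A : Matrix κ κ ℝ≥0) :
    ∃ δ : ℝ≥0, 0 < δ ∧ δ ≤ 1 ∧ ∀ s i j, maxPow A s i j ≠ 0 → δ ^ s ≤ maxPow A s i j := by
  obtain ⟨δ, h0, h1, h⟩ : ∃ δ : ℝ≥0, 0 < δ ∧ δ ≤ 1 ∧ ∀ i j, A i j ≠ 0 → δ ≤ A i j := by
    classical
    let S : Finset ℝ≥0 :=
      insert 1 ((Finset.univ.image fun q : κ × κ => A q.1 q.2).filter (· ≠ 0))
    have hS : S.Nonempty := ⟨1, Finset.mem_insert_self _ _⟩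
    refine ⟨S.min' hS, ?_, S.min'_le 1 (Finset.mem_insert_self _ _), fun i j hij => ?_⟩
    · rcases Finset.mem_insert.1 (S.min'_mem hS) with h | h
      · simp [h]
      · exact pos_iff_ne_zero.2 (Finset.mem_filter.1 h).2
    · exact S.min'_le _ (Finset.mem_insert_of_mem (Finset.mem_filter.2
        ⟨Finset.mem_image.2 ⟨(i, j), Finset.mem_univ _, rfl⟩, hij⟩))
  refine ⟨δ, h0, h1, fun s i j hs => ?_⟩
  induction s generalizing j with
  | zero =>
    by_cases hij : i = j
    · subst hij; simp [maxPow_zero_self]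
    · exact absurd (maxPow_zero_of_ne A hij) hs
  | succ s ih =>
    obtain ⟨k, hk⟩ := exists_maxMul (maxPow A s) A i j
    rw [maxPow, hk] at hs ⊢
    rw [pow_succ]
    exact mul_le_mul' (ih k (left_ne_zero_of_mul hs)) (h k j (right_ne_zero_of_mul hs))

/-! ### Optimal walks -/

/-- A nonzero entry of a power is the weight of a walk. -/
theorem exists_walk (s : ℕ) (i j : κ) (h : maxPow A s i j ≠ 0) :
    ∃ p : ℕ → κ, p 0 = i ∧ p s = j ∧
      maxPow A s i j = ∏ t ∈ Finset.range s, A (p t) (p (t + 1)) := by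
  induction s generalizing j with
  | zero =>
    have hij : i = j := by
      by_contra hij
      exact h (maxPow_zero_of_ne A hij)
    subst hij
    exact ⟨fun _ => i, rfl, rfl, by simp [maxPow_zero_self]⟩
  | succ s ih =>
    obtain ⟨k, hk⟩ := exists_maxMul (maxPow A s) A i j
    have hk' : maxPow A (s + 1) i j = maxPow A s i k * A k j := hk
    obtain ⟨p, h0, hs, hp⟩ := ih k (left_ne_zero_of_mul (hk' ▸ h))
    refine ⟨fun t => if t ≤ s then p t else j, by simpa using h0, by simp, ?_⟩
    rw [hk', hp, Finset.prod_range_succ]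
    congr 1
    · refine Finset.prod_congr rfl fun t ht => ?_
      have := Finset.mem_range.1 ht
      simp [this.le, Nat.succ_le_of_lt this]
    · simp [hs]

theorem prod_le_maxPow (A : Matrix κ κ ℝ≥0) (p : ℕ → κ) (a s : ℕ) :
    ∏ t ∈ Finset.range s, A (p (a + t)) (p (a + t + 1)) ≤ maxPow A s (p a) (p (a + s)) := by
  induction s with
  | zero => simp [maxPow_zero_self]
  | succ s ih =>
    rw [Finset.prod_range_succ]
    exact (mul_le_mul_left ih _).trans (le_maxMul _ _ _ _ _)

/-- An optimal walk can be cut at any of its nodes. -/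
theorem exists_walk_split {s : ℕ} {i j : κ} (h : maxPow A s i j ≠ 0) :
    ∃ p : ℕ → κ, p 0 = i ∧ p s = j ∧
      maxPow A s i j = ∏ t ∈ Finset.range s, A (p t) (p (t + 1)) ∧
      (∀ a ≤ s, maxPow A s i j ≤ maxPow A a i (p a) * maxPow A (s - a) (p a) j) ∧
      ∀ a b, a ≤ b → b ≤ s → maxPow A s i j ≤
        maxPow A a i (p a) * maxPow A (b - a) (p a) (p b) * maxPow A (s - b) (p b) j := by
  obtain ⟨p, h0, hs, hp⟩ := exists_walk s i j h
  have three : ∀ a b, a ≤ b → b ≤ s → maxPow A s i j ≤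
      maxPow A a i (p a) * maxPow A (b - a) (p a) (p b) * maxPow A (s - b) (p b) j := by
    intro a b hab hbs
    obtain ⟨c, rfl⟩ := Nat.exists_eq_add_of_le hab
    obtain ⟨d, rfl⟩ := Nat.exists_eq_add_of_le hbs
    have e1 := prod_le_maxPow A p 0 a
    have e2 := prod_le_maxPow A p a c
    have e3 := prod_le_maxPow A p (a + c) d
    simp only [zero_add, h0, hs] at e1 e3
    rw [hp, Finset.prod_range_add, Finset.prod_range_add]
    simp only [Nat.add_sub_cancel_left]
    exact mul_le_mul' (mul_le_mul' e1 e2) e3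
  refine ⟨p, h0, hs, hp, fun a ha => ?_, three⟩
  simpa [maxPow_zero_self] using three a a le_rfl ha

/-- If all entries are at most `1`, cutting cycles out of an optimal walk bounds every entry of a
power by an entry of a power with small exponent in the same residue class: among the positions
`0, …, n * g` of a longer walk, two carry the same node and are congruent modulo `g`. -/
theorem exists_small_exponent (hA : ∀ i j, A i j ≤ 1) {g : ℕ} (hg : 0 < g) (s : ℕ) (i j : κ) :
    ∃ s' < Fintype.card κ * g, s' ≡ s [MOD g] ∧ maxPow A s i j ≤ maxPow A s' i j := by
  induction s using Nat.strong_induction_on with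
  | _ s ih =>
    by_cases hs : s < Fintype.card κ * g
    · exact ⟨s, hs, rfl, le_rfl⟩
    by_cases h0 : maxPow A s i j = 0
    · have hc : 0 < Fintype.card κ := Fintype.card_pos_iff.2 ⟨i⟩
      exact ⟨s % g, (Nat.mod_lt _ hg).trans_le (Nat.le_mul_of_pos_left _ hc),
        Nat.mod_modEq _ _, by simp [h0]⟩
    suffices ∃ s' < s, s' ≡ s [MOD g] ∧ maxPow A s i j ≤ maxPow A s' i j by
      obtain ⟨s', hlt, hmod, hle⟩ := this
      obtain ⟨t, ht, hmod', hle'⟩ := ih s' hlt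
      exact ⟨t, ht, hmod'.trans hmod, hle.trans hle'⟩
    obtain ⟨p, -, -, -, -, hp⟩ := exists_walk_split h0
    obtain ⟨a, b, hab, hb, hpab, hmod⟩ :
        ∃ a b, a < b ∧ b ≤ s ∧ p a = p b ∧ a ≡ b [MOD g] := by
      obtain ⟨a, ha, b, hb, hne, he⟩ := Finset.exists_ne_map_eq_of_card_lt_of_maps_to
        (s := Finset.range (Fintype.card κ * g + 1))
        (t := (Finset.univ : Finset κ) ×ˢ Finset.range g) (f := fun t => (p t, t % g))
        (by simp) (fun t _ => by simp [Nat.mod_lt _ hg])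
      simp only [Prod.mk.injEq, Finset.mem_range] at he ha hb
      rcases hne.lt_or_gt with h | h
      · exact ⟨a, b, h, by omega, he.1, he.2⟩
      · exact ⟨b, a, h, by omega, he.1.symm, he.2.symm⟩
    refine ⟨a + (s - b), by omega, ?_, ?_⟩
    · have : b + (s - b) = s := by omega
      calc a + (s - b) ≡ b + (s - b) [MOD g] := hmod.add_right _
        _ = s := this
    · calc maxPow A s i j
          ≤ maxPow A a i (p a) * maxPow A (b - a) (p a) (p b) * maxPow A (s - b) (p b) j :=
            hp a b hab.le hb
        _ ≤ maxPow A a i (p a) * 1 * maxPow A (s - b) (p b) j := by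
            gcongr; exact maxPow_le_one hA _ _ _
        _ = maxPow A a i (p a) * maxPow A (s - b) (p a) j := by rw [mul_one, hpab]
        _ ≤ _ := maxPow_mul_le A a (s - b) i (p a) j

end Powers

/-! ### Paths of given length -/

section Paths

variable {κ : Type*} {E F : κ → κ → Prop}

theorem hasPath_zero (i : κ) : HasPath E 0 i i := ⟨fun _ => i, rfl, rfl, by simp⟩

theorem hasPath_zero_iff {i j : κ} : HasPath E 0 i j ↔ i = j :=
  ⟨fun ⟨_, h0, h1, _⟩ => h0.symm.trans h1, fun h => h ▸ hasPath_zero i⟩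

theorem HasPath.trans {a b : ℕ} {i j k : κ} (h₁ : HasPath E a i j) (h₂ : HasPath E b j k) :
    HasPath E (a + b) i k := by
  obtain ⟨p, hp0, hpa, hp⟩ := h₁
  obtain ⟨q, hq0, hqb, hq⟩ := h₂
  refine ⟨fun t => if t ≤ a then p t else q (t - a), by simpa using hp0, ?_, fun t ht => ?_⟩
  · by_cases hb : b = 0
    · subst hb; simp [hpa, ← hq0, hqb]
    · have : ¬ a + b ≤ a := by omega
      simp [hb, hqb]
  · rcases lt_trichotomy t a with h | rfl | h
    · simpa [h.le, Nat.succ_le_of_lt h] using hp t h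
    · have := hq 0 (by omega)
      simpa [hpa, ← hq0] using this
    · have e : t + 1 - a = t - a + 1 := by omega
      have := hq (t - a) (by omega)
      simpa [h.not_ge, show ¬ t + 1 ≤ a by omega, e] using this

theorem hasPath_one {i j : κ} (h : E i j) : HasPath E 1 i j :=
  ⟨fun t => if t = 0 then i else j, by simp, by simp, fun s hs => by
    obtain rfl : s = 0 := by omega
    simpa using h⟩

theorem hasPath_succ_iff {k : ℕ} {i j : κ} :
    HasPath E (k + 1) i j ↔ ∃ u, HasPath E k i u ∧ E u j := by
  constructor
  · rintro ⟨p, h0, h1, hp⟩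
    exact ⟨p k, ⟨p, h0, rfl, fun s hs => hp s (by omega)⟩, h1 ▸ hp k (by omega)⟩
  · rintro ⟨u, hu, huj⟩
    exact hu.trans (hasPath_one huj)

theorem HasPath.mono (hEF : ∀ u v, E u v → F u v) {k : ℕ} {i j : κ} (h : HasPath E k i j) :
    HasPath F k i j := by
  obtain ⟨p, h0, h1, hp⟩ := h
  exact ⟨p, h0, h1, fun s hs => hEF _ _ (hp s hs)⟩

theorem HasPath.iterate {k : ℕ} {i : κ} (h : HasPath E k i i) (m : ℕ) :
    HasPath E (m * k) i i := by
  induction m with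
  | zero => simpa using hasPath_zero i
  | succ m ih => rw [Nat.succ_mul]; exact ih.trans h

theorem HasPath.reflTransGen {k : ℕ} {i j : κ} (h : HasPath E k i j) :
    Relation.ReflTransGen E i j := by
  induction k generalizing j with
  | zero => rw [hasPath_zero_iff.1 h]
  | succ k ih =>
    obtain ⟨u, hu, huj⟩ := hasPath_succ_iff.1 h
    exact (ih hu).tail huj

theorem exists_hasPath {i j : κ} (h : Relation.ReflTransGen E i j) : ∃ k, HasPath E k i j := by
  induction h with
  | refl => exact ⟨0, hasPath_zero i⟩
  | tail _ huv ih =>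
    obtain ⟨k, hk⟩ := ih
    exact ⟨k + 1, hk.trans (hasPath_one huv)⟩

/-- A segment of a walk is a path. -/
theorem hasPath_segment {k : ℕ} {p : ℕ → κ} (hp : ∀ s < k, E (p s) (p (s + 1))) {a b : ℕ}
    (hab : a ≤ b) (hb : b ≤ k) : HasPath E (b - a) (p a) (p b) :=
  ⟨fun t => p (a + t), rfl, by simp [Nat.add_sub_cancel' hab], fun s hs => hp _ (by omega)⟩

theorem maxPow_ne_zero_of_hasPath [Fintype κ] {A : Matrix κ κ ℝ≥0} {k : ℕ} {i j : κ}
    (h : HasPath (fun u v => A u v ≠ 0) k i j) : maxPow A k i j ≠ 0 := by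
  induction k generalizing j with
  | zero => rw [hasPath_zero_iff.1 h, maxPow_zero_self]; exact one_ne_zero
  | succ k ih =>
    obtain ⟨u, hu, huj⟩ := hasPath_succ_iff.1 h
    exact ((pos_iff_ne_zero.2 (mul_ne_zero (ih hu) huj)).trans_le (le_maxMul _ _ _ _ _)).ne'

/-- If all entries are at most `1`, the entries `1` of a power come from the walks along
entries `1`. -/
theorem maxPow_eq_one_iff [Fintype κ] {A : Matrix κ κ ℝ≥0} (hA : ∀ i j, A i j ≤ 1) {k : ℕ}
    {i j : κ} : maxPow A k i j = 1 ↔ HasPath (fun u v => A u v = 1) k i j := by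
  induction k generalizing j with
  | zero =>
    rw [hasPath_zero_iff]
    refine ⟨fun h => ?_, fun h => h ▸ maxPow_zero_self A i⟩
    by_contra hij
    simp [maxPow_zero_of_ne A hij] at h
  | succ k ih =>
    rw [hasPath_succ_iff]
    constructor
    · intro h
      obtain ⟨u, hu⟩ := exists_maxMul (maxPow A k) A i j
      have hu' : maxPow A k i u * A u j = 1 := hu.symm.trans h
      have h1 : maxPow A k i u = 1 := (maxPow_le_one hA k i u).antisymm
        (hu' ▸ mul_le_of_le_one_right' (hA u j))
      exact ⟨u, ih.1 h1, by rwa [h1, one_mul] at hu'⟩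
    · rintro ⟨u, hu, huj⟩
      refine (maxPow_le_one hA _ _ _).antisymm ?_
      have := le_maxMul (maxPow A k) A i u j
      rwa [ih.2 hu, huj, one_mul] at this

end Paths

/-! ### The critical graph -/

section Critical

variable {ι : Type*} [Fintype ι] {A : Matrix ι ι ℝ≥0}

theorem CritEdge.critNode_left {i j : ι} (h : CritEdge A i j) : CritNode A i := by
  obtain ⟨k, σ, hσ, s, hs, hi, -⟩ := h
  exact ⟨k, σ, hσ, s, hs, hi⟩

theorem CritNode.exists_critEdge {i : ι} (h : CritNode A i) : ∃ j, CritEdge A i j := by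
  obtain ⟨k, σ, hσ, s, hs, hi⟩ := h
  exact ⟨_, k, σ, hσ, s, hs, hi, rfl⟩

theorem CritEdge.critNode_right {i j : ι} (h : CritEdge A i j) : CritNode A j := by
  obtain ⟨k, σ, hσ, s, hs, -, hj⟩ := h
  rcases Nat.lt_or_ge (s + 1) k with h | h
  · exact ⟨k, σ, hσ, s + 1, h, hj⟩
  · obtain rfl : k = s + 1 := by omega
    exact ⟨s + 1, σ, hσ, 0, by omega, by rw [← hj, hσ.2.1]⟩

/-- A critical edge lies on a critical cycle, so there is a way back in the critical graph. -/
theorem CritEdge.exists_return {i j : ι} (h : CritEdge A i j) :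
    ∃ m, HasPath (CritEdge A) m j i := by
  obtain ⟨k, σ, hσ, s, hs, rfl, rfl⟩ := h
  have hp : ∀ t < k, CritEdge A (σ t) (σ (t + 1)) := fun t ht => ⟨k, σ, hσ, t, ht, rfl, rfl⟩
  have h1 := hasPath_segment hp (Nat.succ_le_of_lt hs) le_rfl
  have h2 := hasPath_segment hp (Nat.zero_le s) hs.le
  rw [hσ.2.1] at h1
  exact ⟨_, h1.trans h2⟩

theorem exists_critPath_return {k : ℕ} {i j : ι} (h : HasPath (CritEdge A) k i j) :
    ∃ m, HasPath (CritEdge A) m j i := by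
  induction k generalizing j with
  | zero => rw [hasPath_zero_iff.1 h]; exact ⟨0, hasPath_zero j⟩
  | succ k ih =>
    obtain ⟨u, hu, huj⟩ := hasPath_succ_iff.1 h
    obtain ⟨m, hm⟩ := ih hu
    obtain ⟨m', hm'⟩ := huj.exists_return
    exact ⟨m' + m, hm'.trans hm⟩

theorem comp_eq_iff {i j : ι} : comp A i = comp A j ↔ ∃ k, HasPath (CritEdge A) k i j := by
  refine Iff.trans Quotient.eq ⟨fun h => exists_hasPath h.1, fun ⟨k, h⟩ => ?_⟩
  obtain ⟨m, hm⟩ := exists_critPath_return h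
  exact ⟨h.reflTransGen, hm.reflTransGen⟩

theorem CritNode.of_hasPath {k : ℕ} {i j : ι} (hi : CritNode A i)
    (h : HasPath (CritEdge A) k i j) : CritNode A j := by
  cases k with
  | zero => rwa [← hasPath_zero_iff.1 h]
  | succ k =>
    obtain ⟨u, -, huj⟩ := hasPath_succ_iff.1 h
    exact huj.critNode_right

theorem CritNode.of_comp_eq {i j : ι} (hi : CritNode A i) (h : comp A i = comp A j) :
    CritNode A j := by
  obtain ⟨k, hk⟩ := comp_eq_iff.1 h
  exact hi.of_hasPath hk

theorem CritNode.exists_hasPath {i : ι} (hi : CritNode A i) (t : ℕ) :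
    ∃ j, HasPath (CritEdge A) t i j := by
  induction t with
  | zero => exact ⟨i, hasPath_zero i⟩
  | succ t ih =>
    obtain ⟨u, hu⟩ := ih
    obtain ⟨j, hj⟩ := (hi.of_hasPath hu).exists_critEdge
    exact ⟨j, hu.trans (hasPath_one hj)⟩

/-! ### Critical cycles of visualized matrices -/

theorem Visualized.le_one (hv : Visualized A) (i j : ι) : A i j ≤ 1 := hv.2.1 i j

theorem Visualized.isCriticalCycle (hv : Visualized A) {k : ℕ} {σ : ℕ → ι} (hk : 0 < k)
    (h0 : σ k = σ 0) (h : ∀ s < k, A (σ s) (σ (s + 1)) = 1) : IsCriticalCycle A k σ := by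
  refine ⟨hk, h0, fun s hs => by rw [h s hs]; exact one_ne_zero, ?_⟩
  rw [Finset.prod_eq_one fun s hs => h s (Finset.mem_range.1 hs), NNReal.one_rpow]
  exact hv.1.symm

theorem Visualized.critNode (hv : Visualized A) {k : ℕ} {i : ι} (hk : 0 < k)
    (h : HasPath (fun u v => A u v = 1) k i i) : CritNode A i := by
  obtain ⟨p, h0, h1, hp⟩ := h
  exact ⟨k, p, hv.isCriticalCycle hk (h1.trans h0.symm) hp, 0, hk, h0⟩

theorem Visualized.critEdge (hv : Visualized A) {m : ℕ} {i j : ι} (hij : A i j = 1)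
    (h : HasPath (fun u v => A u v = 1) m j i) : CritEdge A i j := by
  obtain ⟨p, h0, h1, hp⟩ := (hasPath_one (E := fun u v => A u v = 1) hij).trans h
  obtain ⟨q, hq0, hqm, hq⟩ := h
  -- the cycle that starts with the edge and closes with the given path
  refine ⟨m + 1, fun t => if t = 0 then i else q (t - 1), hv.isCriticalCycle (by omega)
    (by simp [hqm]) (fun s hs => ?_), 0, by omega, by simp, by simp [hq0]⟩
  rcases s with _ | s
  · simpa [hq0] using hij
  · simpa using hq s (by omega)

theorem Visualized.hasPath_one_of_crit (hv : Visualized A) {k : ℕ} {i j : ι}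
    (h : HasPath (CritEdge A) k i j) :
    HasPath (fun u v => A u v = 1) k i j :=
  h.mono hv.2.2

theorem Visualized.maxPow_eq_one (hv : Visualized A) {k : ℕ} {i j : ι}
    (h : HasPath (CritEdge A) k i j) :
    maxPow A k i j = 1 :=
  (maxPow_eq_one_iff hv.le_one).2 (hv.hasPath_one_of_crit h)

/-- Inside a component of the critical graph, the entries `1` of a power come from walks along
critical edges: close the walk with a critical path. -/
theorem Visualized.hasPath_crit_of_maxPow_eq_one (hv : Visualized A) {k : ℕ} {i j : ι}
    (hc : comp A i = comp A j) (h : maxPow A k i j = 1) : HasPath (CritEdge A) k i j := by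
  obtain ⟨p, rfl, rfl, hp⟩ := (maxPow_eq_one_iff hv.le_one).1 h
  obtain ⟨m, hm⟩ := comp_eq_iff.1 hc.symm
  refine ⟨p, rfl, rfl, fun s hs => hv.critEdge (hp s hs)
    (((hasPath_segment (E := fun u v => A u v = 1) hp (Nat.succ_le_of_lt hs) le_rfl).trans
    (hv.hasPath_one_of_crit hm)).trans
    (hasPath_segment (E := fun u v => A u v = 1) hp (Nat.zero_le s) hs.le))⟩

theorem Visualized.exists_critNode (hv : Visualized A) : ∃ i, CritNode A i := by
  have h1 : maxCycleMean A = 1 := hv.1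
  have hne : (Finset.Icc 1 (Fintype.card ι)).Nonempty := by
    rw [Finset.nonempty_iff_ne_empty]
    intro h
    simp [maxCycleMean, h] at h1
  obtain ⟨k, hk, hk'⟩ := Finset.exists_mem_eq_sup _ hne
    fun k : ℕ => (Finset.univ.sup fun i => maxPow A k i i) ^ (1 / (k : ℝ))
  obtain ⟨hk1, hkn⟩ := Finset.mem_Icc.1 hk
  have : Nonempty ι := Fintype.card_pos_iff.1 (by omega)
  obtain ⟨i, hi⟩ := exists_eq_sup_univ fun i => maxPow A k i i
  have h2 : maxPow A k i i ^ (1 / (k : ℝ)) = 1 := by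
    rw [← hi, ← hk']; exact h1
  have hk0 : (1 / (k : ℝ)) ≠ 0 := by
    have : (k : ℝ) ≠ 0 := by exact_mod_cast (by omega : k ≠ 0)
    exact one_div_ne_zero this
  have h3 : maxPow A k i i = 1 := NNReal.rpow_left_injective hk0 (by simpa using h2)
  exact ⟨i, hv.critNode (by omega) ((maxPow_eq_one_iff hv.le_one).1 h3)⟩

end Critical

/-! ### Cyclicities -/

section Cyclicity

variable {ι : Type*} [Fintype ι] {A : Matrix ι ι ℝ≥0}

/-- The cyclicity of a component is the greatest common divisor of the lengths of the closed walks
at any one of its critical nodes: conjugating a closed walk by a connecting path changes its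
length by the length of another closed walk. -/
theorem compCyclicity_eq_setGcd {i : ι} (hi : CritNode A i) :
    compCyclicity A (comp A i) = Nat.setGcd {k | HasPath (CritEdge A) k i i} ∧
      compCyclicity A (comp A i) ≠ 0 := by
  set S := {k | HasPath (CritEdge A) k i i} with hS
  have hne : Nat.setGcd S ≠ 0 := by
    obtain ⟨j, hj⟩ := hi.exists_critEdge
    obtain ⟨m, hm⟩ := hj.exists_return
    rw [Ne, Nat.setGcd_eq_zero_iff]
    intro h
    have := h ((hasPath_one hj).trans hm : (1 + m) ∈ S)
    simp at this
  have hset : {d : ℕ | ∀ k : ℕ, 0 < k → ∀ j, comp A j = comp A i →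
      HasPath (CritEdge A) k j j → d ∣ k} = {d | d ∣ Nat.setGcd S} := by
    ext d
    simp only [Set.mem_ofPred_eq]
    rw [Nat.dvd_setGcd_iff]
    constructor
    · intro h k hk
      rcases Nat.eq_zero_or_pos k with rfl | hpos
      · exact dvd_zero d
      · exact h k hpos i rfl hk
    · intro h k _ j hj hk
      obtain ⟨a, ha⟩ := comp_eq_iff.1 hj.symm
      obtain ⟨b, hb⟩ := comp_eq_iff.1 hj
      have h1 := h _ (ha.trans hb : (a + b) ∈ S)
      have h2 := h _ ((ha.trans hk).trans hb : (a + k + b) ∈ S)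
      rw [show a + k + b = (a + b) + k by ring] at h2
      exact (Nat.dvd_add_right h1).1 h2
  have key : compCyclicity A (comp A i) = Nat.setGcd S := by
    unfold compCyclicity
    rw [hset]
    exact IsGreatest.csSup_eq ⟨dvd_refl _, fun d hd => Nat.le_of_dvd (by omega) hd⟩
  exact ⟨key, key ▸ hne⟩

/-- At a critical node there are closed walks of every large length divisible by the cyclicity. -/
theorem CritNode.exists_closed_walks {i : ι} (hi : CritNode A i) :
    ∃ M, ∀ m ≥ M, compCyclicity A (comp A i) ∣ m → HasPath (CritEdge A) m i i := by
  obtain ⟨M, hM⟩ := Nat.exists_mem_closure_of_ge {k | HasPath (CritEdge A) k i i}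
  refine ⟨M, fun m hm hd => ?_⟩
  rw [(compCyclicity_eq_setGcd hi).1] at hd
  exact AddSubmonoid.closure_induction (motive := fun k _ => HasPath (CritEdge A) k i i)
    (fun _ h => h) (hasPath_zero i) (fun _ _ _ _ h₁ h₂ => h₁.trans h₂) (hM m hm hd)

theorem compCyclicity_dvd {i : ι} (hi : CritNode A i) :
    compCyclicity A (comp A i) ∣ cyclicity A := by
  refine Finset.dvd_lcm (f := compCyclicity A) ?_
  simpa using ⟨i, hi, rfl⟩

theorem cyclicity_pos (A : Matrix ι ι ℝ≥0) : 0 < cyclicity A := by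
  rw [Nat.pos_iff_ne_zero, cyclicity, Finset.lcm_ne_zero_iff]
  intro μ hμ
  obtain ⟨i, hi, rfl⟩ : CritComp A μ := by simpa using hμ
  exact (compCyclicity_eq_setGcd hi).2

end Cyclicity

/-! ### Ultimate periodicity of the powers -/

section Periodicity

variable {ι : Type*} [Fintype ι] {A : Matrix ι ι ℝ≥0}

/-- `T` bounds the transients of the critical rows, in a form that also compares with the powers
below `T`: from `T` on, an entry in a critical row is the greatest one among all powers in the
same residue class modulo the cyclicity. -/
def DominatesFrom (A : Matrix ι ι ℝ≥0) (T : ℕ) : Prop :=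
  ∀ i, CritNode A i → ∀ s ≥ T, ∀ s', s' ≡ s [MOD cyclicity A] → ∀ l,
    maxPow A s' i l ≤ maxPow A s i l

theorem DominatesFrom.eq {T : ℕ} (hT : DominatesFrom A T) {i : ι} (hi : CritNode A i) {s s' : ℕ}
    (hs : T ≤ s) (hs' : T ≤ s') (h : s' ≡ s [MOD cyclicity A]) (l : ι) :
    maxPow A s' i l = maxPow A s i l :=
  (hT i hi s hs s' h l).antisymm (hT i hi s' hs' s h.symm l)

/-- The maximum over a residue class is attained at a small exponent, and a closed critical walk
in front carries it to every large exponent of that class. -/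
theorem Visualized.exists_dominatesFrom (hv : Visualized A) : ∃ T, DominatesFrom A T := by
  have hM : ∀ i, ∃ M, CritNode A i → ∀ m ≥ M, compCyclicity A (comp A i) ∣ m →
      HasPath (CritEdge A) m i i := fun i => by
    by_cases hi : CritNode A i
    · obtain ⟨M, hM⟩ := hi.exists_closed_walks
      exact ⟨M, fun _ => hM⟩
    · exact ⟨0, fun h => absurd h hi⟩
  choose M hM using hM
  refine ⟨Fintype.card ι * cyclicity A + Finset.univ.sup M, fun i hi s hs s' hmod l => ?_⟩
  obtain ⟨t, ht, htmod, hle⟩ := exists_small_exponent hv.le_one (cyclicity_pos A) s' i l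
  have hMi : M i ≤ Finset.univ.sup M := Finset.le_sup (Finset.mem_univ i)
  have hts : t ≤ s := by omega
  have hdvd : cyclicity A ∣ s - t := (Nat.modEq_iff_dvd' hts).1 (htmod.trans hmod)
  have hpath := hM i hi (s - t) (by omega) ((compCyclicity_dvd hi).trans hdvd)
  calc maxPow A s' i l ≤ maxPow A (s - t) i i * maxPow A t i l := by
        rwa [hv.maxPow_eq_one hpath, one_mul]
    _ ≤ maxPow A (s - t + t) i l := maxPow_mul_le _ _ _ _ _ _
    _ = maxPow A s i l := by rw [Nat.sub_add_cancel hts]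

/-- The nonzero entries of all sufficiently large powers have a common positive lower bound: a
walk can be shortened within its residue class, and then lengthened again by a detour through a
critical node, which costs a bounded factor. -/
theorem Visualized.exists_pos_le (hv : Visualized A) (hirr : Irred A) {T : ℕ}
    (hT : DominatesFrom A T) :
    ∃ ε : ℝ≥0, 0 < ε ∧ ∃ S, ∀ s ≥ S, ∀ k l, maxPow A s k l ≠ 0 → ε ≤ maxPow A s k l := by
  obtain ⟨i, hi⟩ := hv.exists_critNode
  choose d hd using fun u v => exists_hasPath (hirr u v)
  obtain ⟨δ, hδ0, hδ1, hδ⟩ := exists_pos_le_maxPow A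
  set γ := cyclicity A with hγ
  have hγ0 : 0 < γ := cyclicity_pos A
  set c := Finset.univ.sup fun l => d l i + d i l
  refine ⟨δ ^ (Fintype.card ι * γ + γ * c), pow_pos hδ0 _,
    Fintype.card ι * γ + γ * c + T, fun s hs k l h0 => ?_⟩
  obtain ⟨t, ht, htmod, hle⟩ := exists_small_exponent hv.le_one hγ0 s k l
  have ht0 : maxPow A t k l ≠ 0 := ((pos_iff_ne_zero.2 h0).trans_le hle).ne'
  have hc : d l i + d i l ≤ c :=
    Finset.le_sup (f := fun l => d l i + d i l) (Finset.mem_univ l)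
  have hγc : γ * (d l i + d i l) ≤ γ * c := Nat.mul_le_mul_left _ hc
  -- the two halves of the walk `k → l → i → l → i → ⋯ → l`, cut where its segment
  -- `k → l → i` ends
  set e₁ := t + d l i with he₁
  set e₂ := d i l + (γ - 1) * (d l i + d i l) with he₂
  have hsum : e₁ + e₂ = t + γ * (d l i + d i l) := by
    obtain ⟨g, hg⟩ : ∃ g, γ = g + 1 := ⟨γ - 1, by omega⟩
    rw [he₁, he₂, hg, Nat.add_sub_cancel]; ring
  have h₁ : maxPow A e₁ k i ≠ 0 := by
    have := maxPow_ne_zero_of_hasPath (hd l i)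
    exact ((pos_iff_ne_zero.2 (mul_ne_zero ht0 this)).trans_le (maxPow_mul_le _ _ _ _ _ _)).ne'
  have h₂ : maxPow A e₂ i l ≠ 0 :=
    maxPow_ne_zero_of_hasPath ((hd i l).trans (((hd l i).trans (hd i l)).iterate (γ - 1)))
  have he : e₁ + T ≤ s := by omega
  have hmod : e₂ ≡ s - e₁ [MOD γ] := by
    refine Nat.ModEq.add_left_cancel' e₁ ?_
    rw [hsum, Nat.add_sub_cancel' (by omega)]
    exact (Nat.modEq_iff_dvd.2 ⟨-(d l i + d i l), by push_cast; ring⟩ :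
      t + γ * (d l i + d i l) ≡ t [MOD γ]).trans htmod
  calc δ ^ (Fintype.card ι * γ + γ * c) ≤ δ ^ (e₁ + e₂) :=
        pow_le_pow_of_le_one hδ0.le hδ1 (by omega)
    _ = δ ^ e₁ * δ ^ e₂ := pow_add _ _ _
    _ ≤ maxPow A e₁ k i * maxPow A e₂ i l := mul_le_mul' (hδ _ _ _ h₁) (hδ _ _ _ h₂)
    _ ≤ maxPow A e₁ k i * maxPow A (s - e₁) i l := by
        gcongr; exact hT i hi _ (by omega) _ hmod l
    _ ≤ maxPow A (e₁ + (s - e₁)) k l := maxPow_mul_le _ _ _ _ _ _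
    _ = maxPow A s k l := by rw [Nat.add_sub_cancel' (by omega)]

/-- Walks that avoid the critical nodes decay uniformly: every segment with as many edges as there
are nodes contains a cycle, and a cycle through non-critical nodes has an edge of weight less
than `1`. -/
theorem Visualized.exists_decay (hv : Visualized A) {ε : ℝ≥0} (hε : 0 < ε) :
    ∃ S, ∀ s ≥ S, ∀ p : ℕ → ι, (∀ t ≤ s, ¬ CritNode A (p t)) →
      ∏ t ∈ Finset.range s, A (p t) (p (t + 1)) < ε := by
  set n := Fintype.card ι
  obtain ⟨δ, hδ1, hδ⟩ : ∃ δ : ℝ≥0, δ < 1 ∧ ∀ i j, A i j ≠ 1 → A i j ≤ δ := by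
    classical
    refine ⟨Finset.univ.sup fun q : ι × ι => if A q.1 q.2 = 1 then 0 else A q.1 q.2, ?_,
      fun i j hij => ?_⟩
    · refine (Finset.sup_lt_iff (by simp)).2 fun q _ => ?_
      split_ifs with h
      · exact one_pos
      · exact (hv.le_one _ _).lt_of_ne h
    · simpa [hij] using Finset.le_sup
        (f := fun q : ι × ι => if A q.1 q.2 = 1 then 0 else A q.1 q.2) (Finset.mem_univ (i, j))
  have block : ∀ (p : ℕ → ι) a, (∀ t ≤ a + n, ¬ CritNode A (p t)) →
      ∏ t ∈ Finset.range n, A (p (a + t)) (p (a + t + 1)) ≤ δ := by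
    intro p a hp
    obtain ⟨t₀, ht₀, hne⟩ : ∃ t < n, A (p (a + t)) (p (a + t + 1)) ≠ 1 := by
      by_contra! hall
      obtain ⟨b, hb, c, hc, hbc, he⟩ := Finset.exists_ne_map_eq_of_card_lt_of_maps_to
        (s := Finset.range (n + 1)) (t := (Finset.univ : Finset ι)) (f := fun t => p (a + t))
        (by simp [n]) (fun t _ => by simp)
      have hbn := Finset.mem_range.1 hb
      have hcn := Finset.mem_range.1 hc
      rcases hbc.lt_or_gt with h | h
      · have := hasPath_segment (E := fun u v => A u v = 1) (p := fun t => p (a + t)) hall h.le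
          (by omega : c ≤ n)
        exact hp (a + b) (by omega) (hv.critNode (Nat.sub_pos_of_lt h) (he ▸ this))
      · have := hasPath_segment (E := fun u v => A u v = 1) (p := fun t => p (a + t)) hall h.le
          (by omega : b ≤ n)
        exact hp (a + c) (by omega) (hv.critNode (Nat.sub_pos_of_lt h) (he ▸ this))
    calc ∏ t ∈ Finset.range n, A (p (a + t)) (p (a + t + 1))
        ≤ ∏ t ∈ Finset.range n, if t = t₀ then δ else 1 := by
          refine Finset.prod_le_prod' fun t _ => ?_
          split_ifs with h
          · subst h; exact hδ _ _ hne
          · exact hv.le_one _ _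
      _ = δ := by rw [Finset.prod_ite_eq']; simp [ht₀]
  have blocks : ∀ (p : ℕ → ι) m, (∀ t ≤ m * n, ¬ CritNode A (p t)) →
      ∏ t ∈ Finset.range (m * n), A (p t) (p (t + 1)) ≤ δ ^ m := by
    intro p m
    induction m with
    | zero => simp
    | succ m ih =>
      intro hp
      have hmn : (m + 1) * n = m * n + n := Nat.succ_mul m n
      rw [hmn, Finset.prod_range_add, pow_succ]
      exact mul_le_mul' (ih fun t ht => hp t (by omega))
        (block p (m * n) fun t ht => hp t (by omega))
  obtain ⟨m, hm⟩ := exists_pow_lt_of_lt_one hε hδ1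
  refine ⟨m * n, fun s hs p hp => lt_of_le_of_lt ?_ hm⟩
  obtain ⟨b, rfl⟩ := Nat.exists_eq_add_of_le hs
  rw [Finset.prod_range_add]
  exact (mul_le_mul' (blocks p m fun t ht => hp t (by omega))
    (Finset.prod_le_one' fun t _ => hv.le_one _ _)).trans_eq (mul_one _)

/-- The entries of large powers factor through a critical node that is reached after a bounded
number of steps. -/
theorem Visualized.exists_factor (hv : Visualized A) (hirr : Irred A) {T : ℕ}
    (hT : DominatesFrom A T) :
    ∃ P S, P + T ≤ S ∧ ∀ s ≥ S, ∀ k l, ∃ i p, CritNode A i ∧ p ≤ P ∧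
      maxPow A s k l = maxPow A p k i * maxPow A (s - p) i l := by
  obtain ⟨ε, hε, S₁, hS₁⟩ := hv.exists_pos_le hirr hT
  obtain ⟨S₂, hS₂⟩ := hv.exists_decay hε
  set P := Fintype.card ι * cyclicity A
  refine ⟨P, S₁ + S₂ + P + T, by omega, fun s hs k l => ?_⟩
  suffices ∃ i p, CritNode A i ∧ p ≤ P ∧
      maxPow A s k l ≤ maxPow A p k i * maxPow A (s - p) i l by
    obtain ⟨i, p, hi, hp, hle⟩ := this
    refine ⟨i, p, hi, hp, hle.antisymm ((maxPow_mul_le _ _ _ _ _ _).trans_eq ?_)⟩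
    rw [Nat.add_sub_cancel' (by omega)]
  by_cases h0 : maxPow A s k l = 0
  · obtain ⟨i, hi⟩ := hv.exists_critNode
    exact ⟨i, 0, hi, by omega, by simp [h0]⟩
  obtain ⟨w, -, -, hw, hsplit, -⟩ := exists_walk_split h0
  obtain ⟨q, hq, hcrit⟩ : ∃ q ≤ s, CritNode A (w q) := by
    by_contra! hnc
    exact absurd (hS₁ s (by omega) k l h0) (not_le.2 (hw ▸ hS₂ s (by omega) w hnc))
  obtain ⟨p, hp, hpmod, hple⟩ :=
    exists_small_exponent hv.le_one (cyclicity_pos A) q k (w q)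
  refine ⟨w q, p, hcrit, hp.le, (hsplit q hq).trans (mul_le_mul' hple ?_)⟩
  refine hT _ hcrit _ (by omega) _ ?_ l
  refine Nat.ModEq.add_left_cancel hpmod.symm ?_
  rw [Nat.add_sub_cancel' hq, Nat.add_sub_cancel' (by omega)]

/-- The **cyclicity theorem** for irreducible visualized matrices. -/
theorem Visualized.exists_period (hv : Visualized A) (hirr : Irred A) :
    ∃ T, ∀ s, T ≤ s → maxPow A (s + cyclicity A) = maxPow A s := by
  obtain ⟨T, hT⟩ := hv.exists_dominatesFrom
  obtain ⟨P, S, hPS, hS⟩ := hv.exists_factor hirr hT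
  refine ⟨S, fun s hs => ?_⟩
  ext k l
  refine congrArg _ (le_antisymm ?_ ?_)
  · obtain ⟨i, p, hi, hp, he⟩ := hS (s + cyclicity A) (by omega) k l
    rw [he, hT.eq hi (s := s - p) (by omega) (by omega)]
    · refine (maxPow_mul_le _ _ _ _ _ _).trans_eq ?_
      rw [Nat.add_sub_cancel' (by omega)]
    · rw [Nat.sub_add_comm (by omega)]
      exact Nat.add_modEq_right
  · obtain ⟨i, p, hi, hp, he⟩ := hS s hs k l
    rw [he, hT.eq hi (s := s + cyclicity A - p) (by omega) (by omega)]
    · refine (maxPow_mul_le _ _ _ _ _ _).trans_eq ?_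
      rw [Nat.add_sub_cancel' (by omega)]
    · rw [Nat.sub_add_comm (by omega)]
      exact Nat.add_modEq_right.symm

end Periodicity

/-! ### Critical rows in the periodic regime -/

section Rows

variable {ι : Type*} [Fintype ι] {A : Matrix ι ι ℝ≥0} {T : ℕ}

theorem Visualized.maxPow_add_cyclicity (hv : Visualized A) (hirr : Irred A) (s : ℕ)
    (hs : transient A ≤ s) : maxPow A (s + cyclicity A) = maxPow A s :=
  Nat.sInf_mem (s := {T : ℕ | ∀ s, T ≤ s → maxPow A (s + cyclicity A) = maxPow A s})
    (hv.exists_period hirr) s hs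

theorem maxPow_add_mul_cyclicity
    (hT : ∀ s, T ≤ s → maxPow A (s + cyclicity A) = maxPow A s) {s : ℕ} (hs : T ≤ s) (m : ℕ) :
    maxPow A (s + m * cyclicity A) = maxPow A s := by
  induction m with
  | zero => simp
  | succ m ih => rw [Nat.succ_mul, ← add_assoc, hT _ (by omega), ih]

theorem maxPow_eq_of_modEq
    (hT : ∀ s, T ≤ s → maxPow A (s + cyclicity A) = maxPow A s) {s s' : ℕ} (hs : T ≤ s)
    (hs' : T ≤ s') (h : s ≡ s' [MOD cyclicity A]) : maxPow A s = maxPow A s' := by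
  wlog hle : s ≤ s' generalizing s s'
  · exact (this hs' hs h.symm (by omega)).symm
  obtain ⟨m, hm⟩ := (Nat.modEq_iff_dvd' hle).1 h
  obtain rfl : s' = s + m * cyclicity A := by rw [mul_comm, ← hm]; omega
  exact (maxPow_add_mul_cyclicity hT hs m).symm

/-- Following a critical path of length `k` shifts the exponent of a critical row by `k`. -/
theorem Visualized.row_shift (hv : Visualized A)
    (hT : ∀ s, T ≤ s → maxPow A (s + cyclicity A) = maxPow A s) {k : ℕ} {i j : ι}
    (h : HasPath (CritEdge A) k i j) {s : ℕ} (hs : T ≤ s) (l : ι) :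
    maxPow A (s + k) i l = maxPow A s j l := by
  apply le_antisymm
  · obtain ⟨m, hm⟩ := exists_critPath_return h
    -- return to `i` by a path that completes a multiple of the cyclicity
    have hback := ((hm.trans h).iterate (cyclicity A - 1)).trans hm
    have h1 := maxPow_mul_le A ((cyclicity A - 1) * (m + k) + m) (s + k) j i l
    rw [hv.maxPow_eq_one hback, one_mul] at h1
    refine h1.trans_eq ?_
    have : (cyclicity A - 1) * (m + k) + m + (s + k) = s + (m + k) * cyclicity A := by
      obtain ⟨g, hg⟩ : ∃ g, cyclicity A = g + 1 :=
        ⟨cyclicity A - 1, by have := cyclicity_pos A; omega⟩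
      rw [hg, Nat.add_sub_cancel]; ring
    rw [this, maxPow_add_mul_cyclicity hT hs]
  · have h1 := maxPow_mul_le A k s i j l
    rwa [hv.maxPow_eq_one h, one_mul, add_comm] at h1

/-- The rows of a component of the critical graph have the cyclicity of that component as a
period. -/
theorem Visualized.row_eq_of_modEq (hv : Visualized A)
    (hT : ∀ s, T ≤ s → maxPow A (s + cyclicity A) = maxPow A s) {i : ι} (hi : CritNode A i)
    {s s' : ℕ} (hs : T ≤ s) (hs' : T ≤ s') (h : s ≡ s' [MOD compCyclicity A (comp A i)])
    (l : ι) : maxPow A s i l = maxPow A s' i l := by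
  wlog hle : s ≤ s' generalizing s s'
  · exact (this hs' hs h.symm (by omega)).symm
  obtain ⟨M, hM⟩ := hi.exists_closed_walks
  have hd := (Nat.modEq_iff_dvd' hle).1 h
  set g := compCyclicity A (comp A i)
  have hg : 0 < g := Nat.pos_of_ne_zero (compCyclicity_eq_setGcd hi).2
  have hMg : M ≤ M * g := Nat.le_mul_of_pos_right M hg
  have h1 := hv.row_shift hT (hM (M * g) hMg (Dvd.intro_left _ rfl)) hs' l
  have h2 := hv.row_shift hT
    (hM (s' - s + M * g) (by omega) (dvd_add hd (Dvd.intro_left _ rfl))) hs l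
  rw [← h1, ← h2]
  congr 1
  omega

theorem Visualized.row_shift_of_modEq (hv : Visualized A)
    (hT : ∀ s, T ≤ s → maxPow A (s + cyclicity A) = maxPow A s) {k t : ℕ} {i j : ι}
    (hi : CritNode A i) (h : HasPath (CritEdge A) k i j)
    (hk : k ≡ t [MOD compCyclicity A (comp A i)]) {s : ℕ} (hs : T ≤ s) (l : ι) :
    maxPow A (s + t) i l = maxPow A s j l := by
  rw [← hv.row_shift hT h hs l]
  exact hv.row_eq_of_modEq hT hi (by omega) (by omega) (hk.symm.add_left s) l

theorem mem_cyclicClass {i j : ι} : j ∈ cyclicClass A i ↔ CyclicEquiv A i j := by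
  simp [cyclicClass]

theorem self_mem_cyclicClass (i : ι) : i ∈ cyclicClass A i :=
  mem_cyclicClass.2 ⟨rfl, 0, hasPath_zero i, rfl⟩

theorem CritEdge.access {i j : ι} (h : CritEdge A i j) : Access A 1 i j :=
  ⟨i, self_mem_cyclicClass i, j, self_mem_cyclicClass j, 1, hasPath_one h, rfl⟩

/-- The nodes of a cyclic class have equal rows in the periodic regime. -/
theorem Visualized.row_eq_of_cyclicEquiv (hv : Visualized A)
    (hT : ∀ s, T ≤ s → maxPow A (s + cyclicity A) = maxPow A s) {i j : ι} (hi : CritNode A i)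
    (h : CyclicEquiv A i j) {s : ℕ} (hs : T ≤ s) (l : ι) :
    maxPow A s i l = maxPow A s j l := by
  obtain ⟨-, k, hk, hmod⟩ := h
  exact hv.row_shift_of_modEq hT hi hk hmod hs l

theorem Access.comp_eq {t : ℕ} {i j : ι} (h : Access A t i j) : comp A i = comp A j := by
  obtain ⟨i', hi', j', hj', k, hk, -⟩ := h
  exact (mem_cyclicClass.1 hi').1.trans
    ((comp_eq_iff.2 ⟨k, hk⟩).trans (mem_cyclicClass.1 hj').1.symm)

/-- For an exponent divisible by the cyclicity, the entries `1` of a critical row inside its own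
component mark the cyclic class. -/
theorem Visualized.maxPow_eq_one_iff_cyclicEquiv (hv : Visualized A)
    (hT : ∀ s, T ≤ s → maxPow A (s + cyclicity A) = maxPow A s) {i j : ι} (hi : CritNode A i)
    {r : ℕ} (hr : T ≤ r) (hγ : cyclicity A ∣ r) :
    comp A i = comp A j ∧ maxPow A r i j = 1 ↔ CyclicEquiv A i j := by
  constructor
  · rintro ⟨hc, h1⟩
    exact ⟨hc, r, hv.hasPath_crit_of_maxPow_eq_one hc h1,
      Nat.modEq_zero_iff_dvd.2 ((compCyclicity_dvd hi).trans hγ)⟩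
  · intro h
    have hj : CritNode A j := hi.of_comp_eq h.1
    obtain ⟨M, hM⟩ := hj.exists_closed_walks
    have hMγ : M + T ≤ (M + T) * cyclicity A := Nat.le_mul_of_pos_right _ (cyclicity_pos A)
    have hpath := hM ((M + T) * cyclicity A) (by omega)
      ((compCyclicity_dvd hj).trans (Dvd.intro_left _ rfl))
    refine ⟨h.1, ?_⟩
    rw [hv.row_eq_of_cyclicEquiv hT hi h hr, maxPow_eq_of_modEq hT hr (by omega)
      ((Nat.modEq_zero_iff_dvd.2 hγ).trans
        (Nat.modEq_zero_iff_dvd.2 (Dvd.intro_left (M + T) rfl)).symm), hv.maxPow_eq_one hpath]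

/-- If `A ^ r ⊗ x` and `A ^ (r + 1) ⊗ x` agree at the critical nodes, they are equal: critical
paths transport the equality to all exponents from `r` on, and large powers factor through
critical nodes. -/
theorem Visualized.maxMulVec_eq_of_crit (hv : Visualized A) (hirr : Irred A)
    (hT : ∀ s, T ≤ s → maxPow A (s + cyclicity A) = maxPow A s) {r : ℕ} (hr : T ≤ r)
    {x : ι → ℝ≥0} (h : ∀ i, CritNode A i →
      maxMulVec (maxPow A r) x i = maxMulVec (maxPow A (r + 1)) x i) :
    maxMulVec (maxPow A r) x = maxMulVec (maxPow A (r + 1)) x := by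
  have hcrit : ∀ s ≥ r, ∀ i, CritNode A i →
      maxMulVec (maxPow A s) x i = maxMulVec (maxPow A (s + 1)) x i := by
    intro s hs i hi
    obtain ⟨t, rfl⟩ := Nat.exists_eq_add_of_le hs
    obtain ⟨j, hj⟩ := hi.exists_hasPath t
    rw [maxMulVec_congr_row (hv.row_shift hT hj hr) x, h j (hi.of_hasPath hj), add_right_comm,
      maxMulVec_congr_row (hv.row_shift hT hj (by omega : T ≤ r + 1)) x]
  obtain ⟨T', hT'⟩ := hv.exists_dominatesFrom
  obtain ⟨P, S, -, hS⟩ := hv.exists_factor hirr hT'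
  have hle : ∀ s s', S ≤ s → P ≤ s' → (∀ i, CritNode A i → ∀ p ≤ P,
      maxMulVec (maxPow A (s - p)) x i = maxMulVec (maxPow A (s' - p)) x i) →
      maxMulVec (maxPow A s) x ≤ maxMulVec (maxPow A s') x := by
    intro s s' hs hs' he k
    refine maxMulVec_le fun l => ?_
    obtain ⟨i, p, hi, hp, hf⟩ := hS s hs k l
    obtain ⟨l', hl'⟩ := exists_maxMulVec (maxPow A (s' - p)) x i
    calc maxPow A s k l * x l = maxPow A p k i * (maxPow A (s - p) i l * x l) := by
          rw [hf, mul_assoc]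
      _ ≤ maxPow A p k i * maxMulVec (maxPow A (s - p)) x i := by
          gcongr; exact le_maxMulVec _ _ _ _
      _ = maxPow A p k i * maxPow A (s' - p) i l' * x l' := by rw [he i hi p hp, hl', mul_assoc]
      _ ≤ maxPow A s' k l' * x l' := by
          gcongr
          have := maxPow_mul_le A p (s' - p) k i l'
          rwa [Nat.add_sub_cancel' (by omega)] at this
      _ ≤ _ := le_maxMulVec _ _ _ _
  have hN : P + S ≤ (P + S) * cyclicity A := Nat.le_mul_of_pos_right _ (cyclicity_pos A)
  set s := r + (P + S) * cyclicity A with hs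
  have h1 : maxPow A s = maxPow A r := maxPow_add_mul_cyclicity hT hr _
  have h2 : maxPow A (s + 1) = maxPow A (r + 1) := by
    rw [hs, add_right_comm]
    exact maxPow_add_mul_cyclicity hT (by omega) _
  rw [← h1, ← h2]
  refine le_antisymm (hle s (s + 1) (by omega) (by omega) fun i hi p hp => ?_)
    (hle (s + 1) s (by omega) (by omega) fun i hi p hp => ?_)
  · rw [hcrit (s - p) (by omega) i hi, (by omega : s - p + 1 = s + 1 - p)]
  · rw [hcrit (s - p) (by omega) i hi, (by omega : s - p + 1 = s + 1 - p)]

end Rows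

/-! ### The core matrix and its Kleene star -/

section Core

variable {ι : Type*} [Fintype ι] {A : Matrix ι ι ℝ≥0}

theorem le_core (A : Matrix ι ι ℝ≥0) (i j : ι) : A i j ≤ core A (comp A i) (comp A j) := by
  unfold core
  refine le_trans ?_ (Finset.le_sup (b := i) (by simp))
  exact Finset.le_sup (f := fun j => A i j) (by simp)

theorem exists_core_eq (A : Matrix ι ι ℝ≥0) (μ ν : Comp A) :
    ∃ i j, comp A i = μ ∧ comp A j = ν ∧ core A μ ν = A i j := by
  classical
  obtain ⟨i₀, hi₀⟩ : ∃ i, comp A i = μ := Quotient.exists_rep μ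
  obtain ⟨j₀, hj₀⟩ : ∃ j, comp A j = ν := Quotient.exists_rep ν
  unfold core
  obtain ⟨i, hi, hi'⟩ := Finset.exists_mem_eq_sup (Finset.univ.filter fun i => comp A i = μ)
    ⟨i₀, by simp [hi₀]⟩ fun i => (Finset.univ.filter fun j => comp A j = ν).sup fun j => A i j
  obtain ⟨j, hj, hj'⟩ := Finset.exists_mem_eq_sup (Finset.univ.filter fun j => comp A j = ν)
    ⟨j₀, by simp [hj₀]⟩ fun j => A i j
  refine ⟨i, j, by simpa using hi, by simpa using hj, ?_⟩
  rw [← hj', ← hi']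

theorem Visualized.core_le_one (hv : Visualized A) (μ ν : Comp A) : core A μ ν ≤ 1 := by
  obtain ⟨i, j, -, -, h⟩ := exists_core_eq A μ ν
  exact h ▸ hv.le_one i j

theorem maxPow_le_core (A : Matrix ι ι ℝ≥0) (s : ℕ) (i j : ι) :
    maxPow A s i j ≤ maxPow (core A) s (comp A i) (comp A j) := by
  induction s generalizing j with
  | zero =>
    by_cases h : i = j
    · subst h; simp [maxPow_zero_self]
    · simp [maxPow_zero_of_ne A h]
  | succ s ih =>
    refine Finset.sup_le fun k _ => ?_
    exact (mul_le_mul' (ih k) (le_core A k j)).trans (le_maxMul _ _ _ _ _)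

theorem Visualized.maxPow_core_le_coreStar (hv : Visualized A) (s : ℕ) (μ ν : Comp A) :
    maxPow (core A) s μ ν ≤ coreStar A μ ν :=
  le_ciSup (f := fun k => maxPow (core A) k μ ν)
    ⟨1, by rintro _ ⟨k, rfl⟩; exact maxPow_le_one hv.core_le_one k μ ν⟩ s

theorem Visualized.maxPow_le_coreStar (hv : Visualized A) (s : ℕ) (i j : ι) :
    maxPow A s i j ≤ coreStar A (comp A i) (comp A j) :=
  (maxPow_le_core A s i j).trans (hv.maxPow_core_le_coreStar s _ _)

theorem Visualized.coreStar_self (hv : Visualized A) (μ : Comp A) : coreStar A μ μ = 1 := by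
  refine le_antisymm (ciSup_le fun k => maxPow_le_one hv.core_le_one k μ μ) ?_
  rw [← maxPow_zero_self (core A) μ]
  exact hv.maxPow_core_le_coreStar 0 μ μ

/-- A walk in the core graph lifts to a walk between any nodes of its end components, because
moving inside a component along critical edges costs nothing. -/
theorem Visualized.exists_maxPow_core_le (hv : Visualized A) (m : ℕ) (i k : ι) :
    ∃ L, maxPow (core A) m (comp A i) (comp A k) ≤ maxPow A L i k := by
  induction m generalizing k with
  | zero =>
    by_cases h : comp A i = comp A k
    · obtain ⟨L, hL⟩ := comp_eq_iff.1 h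
      exact ⟨L, by rw [hv.maxPow_eq_one hL]; exact maxPow_le_one hv.core_le_one _ _ _⟩
    · exact ⟨0, by simp [maxPow_zero_of_ne _ h]⟩
  | succ m ih =>
    obtain ⟨ρ, hρ⟩ := exists_maxMul (maxPow (core A) m) (core A) (comp A i) (comp A k)
    obtain ⟨u, v, rfl, hv', huv⟩ := exists_core_eq A ρ (comp A k)
    obtain ⟨L, hL⟩ := ih u
    obtain ⟨L', hL'⟩ := comp_eq_iff.1 hv'
    refine ⟨L + 1 + L', ?_⟩
    calc maxPow (core A) (m + 1) (comp A i) (comp A k)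
        = maxPow (core A) m (comp A i) (comp A u) * A u v := by rw [← huv]; exact hρ
      _ ≤ maxPow A L i u * A u v := by gcongr
      _ ≤ maxPow A (L + 1) i v := le_maxMul _ _ _ _ _
      _ = maxPow A (L + 1) i v * maxPow A L' v k := by rw [hv.maxPow_eq_one hL', mul_one]
      _ ≤ maxPow A (L + 1 + L') i k := maxPow_mul_le _ _ _ _ _ _

/-- Every entry `α*_{μν}` with `μ` critical is attained in each column of `N_ν` by some row of
`N_μ`, at every exponent of the periodic regime. -/
theorem Visualized.exists_maxPow_eq_coreStar (hv : Visualized A) {T : ℕ}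
    (hT : ∀ s, T ≤ s → maxPow A (s + cyclicity A) = maxPow A s) {r : ℕ} (hr : T ≤ r) {i : ι}
    (hi : CritNode A i) (k : ι) :
    ∃ i', comp A i' = comp A i ∧ maxPow A r i' k = coreStar A (comp A i) (comp A k) := by
  classical
  obtain ⟨i', hi', hmax⟩ := Finset.exists_max_image
    (Finset.univ.filter fun j => comp A j = comp A i) (fun j => maxPow A r j k) ⟨i, by simp⟩
  have hi'' : comp A i' = comp A i := by simpa using hi'
  refine ⟨i', hi'', le_antisymm (hi'' ▸ hv.maxPow_le_coreStar r i' k) (ciSup_le fun m => ?_)⟩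
  obtain ⟨L, hL⟩ := hv.exists_maxPow_core_le m i k
  obtain ⟨T', hT'⟩ := hv.exists_dominatesFrom
  -- lengthen the walk beyond `r`, then trade the surplus for a shift of the row
  have hN : T' + r ≤ (T' + r) * cyclicity A := Nat.le_mul_of_pos_right _ (cyclicity_pos A)
  set s := L + (T' + r) * cyclicity A with hs
  have hLs : L ≡ s [MOD cyclicity A] := by simp [hs, Nat.ModEq]
  obtain ⟨t, ht⟩ := Nat.exists_eq_add_of_le (by omega : r ≤ s)
  obtain ⟨j, hj⟩ := hi.exists_hasPath t
  calc maxPow (core A) m (comp A i) (comp A k) ≤ maxPow A L i k := hL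
    _ ≤ maxPow A s i k := hT' i hi s (by omega) L hLs k
    _ = maxPow A r j k := by rw [ht, hv.row_shift hT hj hr]
    _ ≤ maxPow A r i' k := hmax j (by simp [comp_eq_iff.2 ⟨t, hj⟩])

end Core

/-! ### The concise system -/

section Concise

variable {ι : Type*} [Fintype ι] {A : Matrix ι ι ℝ≥0} {T r : ℕ}

theorem eq_of_comp_eq {β : Type*} {f : ι → β} (hf : ∀ i j, CritEdge A i j → f i = f j) {i j : ι}
    (h : comp A i = comp A j) : f i = f j := by
  obtain ⟨k, hk⟩ := comp_eq_iff.1 h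
  have hpath := hk.reflTransGen
  clear hk h
  induction hpath with
  | refl => rfl
  | tail _ huv ih => exact ih.trans (hf _ _ huv)

theorem Visualized.chainSide_le (hv : Visualized A)
    (hT : ∀ s, T ≤ s → maxPow A (s + cyclicity A) = maxPow A s) (hr : T ≤ r)
    (hγ : cyclicity A ∣ r) {i : ι} (hi : CritNode A i) (x : ι → ℝ≥0) :
    chainSide A r i x ≤ maxMulVec (maxPow A r) x i := by
  refine sup_le (sup_le (Finset.sup_le fun k hk => ?_) (Finset.sup_le fun ν _ => ?_))
    (Finset.sup_le fun t ht => ?_)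
  · have h1 := ((hv.maxPow_eq_one_iff_cyclicEquiv hT hi hr hγ).2 (mem_cyclicClass.1 hk)).2
    simpa [h1] using le_maxMulVec (maxPow A r) x i k
  · rcases (indexM A r ν i).eq_empty_or_nonempty with h | h
    · simp [h]
    · obtain ⟨k, hk, hx⟩ := Finset.exists_mem_eq_sup _ h x
      simp only [indexM, Finset.mem_filter] at hk
      rw [hx, ← hk.2.2]
      exact le_maxMulVec _ _ _ _
  · simp only [indexK, Finset.mem_filter] at ht
    rw [← ht.2.2]
    exact le_maxMulVec _ _ _ _

/-- The concise side keeps every term whose entry equals `α*`. For a node of the component of `i`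
this uses `α* = 1`, which singles out the cyclic class. -/
theorem Visualized.le_chainSide (hv : Visualized A)
    (hT : ∀ s, T ≤ s → maxPow A (s + cyclicity A) = maxPow A s) (hr : T ≤ r)
    (hγ : cyclicity A ∣ r) {i : ι} (hi : CritNode A i) (x : ι → ℝ≥0) {k : ι}
    (hk : maxPow A r i k = coreStar A (comp A i) (comp A k)) :
    coreStar A (comp A i) (comp A k) * x k ≤ chainSide A r i x := by
  by_cases hc : comp A i = comp A k
  · rw [← hc, hv.coreStar_self] at hk
    rw [← hc, hv.coreStar_self, one_mul]
    have hmem := mem_cyclicClass.2 ((hv.maxPow_eq_one_iff_cyclicEquiv hT hi hr hγ).1 ⟨hc, hk⟩)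
    exact le_sup_of_le_left (le_sup_of_le_left (Finset.le_sup hmem))
  by_cases hcrit : CritNode A k
  · refine le_sup_of_le_left (le_sup_of_le_right ?_)
    refine le_trans ?_ (Finset.le_sup (b := comp A k) ?_)
    · have hmem : k ∈ indexM A r (comp A k) i := by simp [indexM, hk]
      exact mul_le_mul_right (Finset.le_sup hmem) _
    · simpa using ⟨⟨k, hcrit, rfl⟩, Ne.symm hc⟩
  · refine le_sup_of_le_right ?_
    exact Finset.le_sup (f := fun t => coreStar A (comp A i) (comp A t) * x t)
      (by simp [indexK, hk, hcrit])

/-- If `A ^ r ⊗ x` is constant on the component of `i`, it is given there by the concise sides: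
the full row can only attain the constant at an entry equal to `α*`, since the same column with
factor `α*` occurs in some row of the component. -/
theorem Visualized.chainSide_eq_of_maxMulVec_const (hv : Visualized A)
    (hT : ∀ s, T ≤ s → maxPow A (s + cyclicity A) = maxPow A s) (hr : T ≤ r)
    (hγ : cyclicity A ∣ r) {i : ι} (hi : CritNode A i) {x : ι → ℝ≥0}
    (h : ∀ j, comp A j = comp A i → maxMulVec (maxPow A r) x j = maxMulVec (maxPow A r) x i) :
    chainSide A r i x = maxMulVec (maxPow A r) x i := by
  refine (hv.chainSide_le hT hr hγ hi x).antisymm ?_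
  obtain ⟨k, hk⟩ := exists_maxMulVec (maxPow A r) x i
  rcases eq_or_ne (x k) 0 with hx | hx
  · simp [hk, hx]
  obtain ⟨i', hc, hi'⟩ := hv.exists_maxPow_eq_coreStar hT hr hi k
  have hle : maxPow A r i' k * x k ≤ maxPow A r i k * x k := by
    rw [← hk, ← h i' hc]
    exact le_maxMulVec _ _ _ _
  have heq : maxPow A r i k = coreStar A (comp A i) (comp A k) :=
    (hv.maxPow_le_coreStar r i k).antisymm
      (hi' ▸ le_of_mul_le_mul_right hle (pos_iff_ne_zero.2 hx))
  rw [hk, heq]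
  exact hv.le_chainSide hT hr hγ hi x heq

/-- If the concise sides are constant on the component of `i`, they give `A ^ r ⊗ x` there: a term
of the full row is at most a term of the concise side of some other row of the component. -/
theorem Visualized.chainSide_eq_of_chainSide_const (hv : Visualized A)
    (hT : ∀ s, T ≤ s → maxPow A (s + cyclicity A) = maxPow A s) (hr : T ≤ r)
    (hγ : cyclicity A ∣ r) {i : ι} (hi : CritNode A i) {x : ι → ℝ≥0}
    (h : ∀ j, comp A j = comp A i → chainSide A r j x = chainSide A r i x) :
    chainSide A r i x = maxMulVec (maxPow A r) x i := by
  refine (hv.chainSide_le hT hr hγ hi x).antisymm (maxMulVec_le fun k => ?_)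
  obtain ⟨i', hc, hi'⟩ := hv.exists_maxPow_eq_coreStar hT hr hi k
  have h1 := hv.le_chainSide hT hr hγ (hi.of_comp_eq hc.symm) x (hc ▸ hi')
  rw [hc, h i' hc] at h1
  exact (mul_le_mul_left (hv.maxPow_le_coreStar r i k) _).trans h1

end Concise

/-! ### Solutions and the attraction cone -/

section Attr

variable {ι : Type*} [Fintype ι] {A : Matrix ι ι ℝ≥0} {T r : ℕ}

/-- In the periodic regime the equation `A ^ r ⊗ x = A ^ (r + 1) ⊗ x` describes the attraction
cone: an equality at some exponent persists, and can be moved back to `r` by periodicity. -/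
theorem setOf_maxMulVec_eq_attr
    (hT : ∀ s, T ≤ s → maxPow A (s + cyclicity A) = maxPow A s) (hr : T ≤ r) :
    {x : ι → ℝ≥0 | maxMulVec (maxPow A r) x = maxMulVec (maxPow A (r + 1)) x} = attr A 1 := by
  ext x
  refine ⟨fun h => ⟨r, h⟩, fun ⟨s, hs⟩ => ?_⟩
  have hγ : s ≤ s * cyclicity A := Nat.le_mul_of_pos_right s (cyclicity_pos A)
  obtain ⟨a, ha⟩ := Nat.exists_eq_add_of_le (by omega : s ≤ r + s * cyclicity A)
  have key : maxMulVec (maxPow A (r + s * cyclicity A)) x =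
      maxMulVec (maxPow A (r + s * cyclicity A + 1)) x := by
    rw [ha, add_comm s a, add_assoc, maxMulVec_maxPow_add, maxMulVec_maxPow_add, hs]
  rwa [add_right_comm, maxPow_add_mul_cyclicity hT hr,
    maxPow_add_mul_cyclicity hT (by omega : T ≤ r + 1)] at key

end Attr

end MaxAlg

theorem theorem6p1 {ι : Type*} [Fintype ι] (A : Matrix ι ι ℝ≥0)
    (hirr : MaxAlg.Irred A) (hvis : MaxAlg.Visualized A)
    (r : ℕ) (hr : MaxAlg.transient A ≤ r) (hγ : MaxAlg.cyclicity A ∣ r) :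
    -- the solutions of `A ^ r ⊗ x = A ^ (r + 1) ⊗ x` form the attraction cone `Attr(A, 1)`
    {x : ι → ℝ≥0 | MaxAlg.maxMulVec (MaxAlg.maxPow A r) x =
      MaxAlg.maxMulVec (MaxAlg.maxPow A (r + 1)) x} = MaxAlg.attr A 1 ∧
    -- the index sets depend only on the cyclic class of the critical node `i`
    (∀ i i' : ι, MaxAlg.CritNode A i → i' ∈ MaxAlg.cyclicClass A i →
      (∀ ν : MaxAlg.Comp A, MaxAlg.CritComp A ν → ν ≠ MaxAlg.comp A i →
        MaxAlg.indexM A r ν i = MaxAlg.indexM A r ν i') ∧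
      MaxAlg.indexK A r i = MaxAlg.indexK A r i') ∧
    -- the system is equivalent to one equation for each pair `[i] →_1 [j]` of cyclic classes
    ∀ x : ι → ℝ≥0,
      (MaxAlg.maxMulVec (MaxAlg.maxPow A r) x =
          MaxAlg.maxMulVec (MaxAlg.maxPow A (r + 1)) x ↔
        ∀ i j : ι, MaxAlg.CritNode A i → MaxAlg.CritNode A j → MaxAlg.Access A 1 i j →
          MaxAlg.chainSide A r i x = MaxAlg.chainSide A r j x) := by
  have hT := hvis.maxPow_add_cyclicity hirr
  refine ⟨MaxAlg.setOf_maxMulVec_eq_attr hT hr, fun i i' hi hi' => ?_, fun x => ?_⟩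
  · have hequiv := MaxAlg.mem_cyclicClass.1 hi'
    have hrow := hvis.row_eq_of_cyclicEquiv hT hi hequiv hr
    constructor
    · intro ν _ _
      ext j
      simp [MaxAlg.indexM, hrow, hequiv.1]
    · ext t
      simp [MaxAlg.indexK, hrow, hequiv.1]
  · constructor
    · intro hx i j hi hj hij
      have hconst : ∀ u v, MaxAlg.comp A u = MaxAlg.comp A v →
          MaxAlg.maxMulVec (MaxAlg.maxPow A r) x u = MaxAlg.maxMulVec (MaxAlg.maxPow A r) x v :=
        fun u v => MaxAlg.eq_of_comp_eq fun u v huv => by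
          rw [← MaxAlg.maxMulVec_congr_row (hvis.row_shift hT (MaxAlg.hasPath_one huv) hr) x, ← hx]
      rw [hvis.chainSide_eq_of_maxMulVec_const hT hr hγ hi fun u hu => hconst u i hu,
        hvis.chainSide_eq_of_maxMulVec_const hT hr hγ hj fun u hu => hconst u j hu,
        hconst i j hij.comp_eq]
    · intro h
      have hconst : ∀ u v, MaxAlg.comp A u = MaxAlg.comp A v →
          MaxAlg.chainSide A r u x = MaxAlg.chainSide A r v x :=
        fun u v => MaxAlg.eq_of_comp_eq fun u v huv =>
          h u v huv.critNode_left huv.critNode_right huv.access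
      refine hvis.maxMulVec_eq_of_crit hirr hT hr fun i hi => ?_
      obtain ⟨j, hij⟩ := hi.exists_critEdge
      have hpath := MaxAlg.hasPath_one hij
      rw [MaxAlg.maxMulVec_congr_row (hvis.row_shift hT hpath hr) x,
        ← hvis.chainSide_eq_of_chainSide_const hT hr hγ hi fun u hu => hconst u i hu,
        ← hvis.chainSide_eq_of_chainSide_const hT hr hγ hij.critNode_right
          fun u hu => hconst u j hu,
        hconst i j (MaxAlg.comp_eq_iff.2 ⟨1, hpath⟩)]
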